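/- Let $f:\mathbb{R}^n\to\mathbb{R}$ and $g:\mathbb{R}^n\to\mathbb{R}^m$ be continuously differentiable, let $K\subseteq\mathbb{R}^m$ be closed, and put $C:=g^{-1}(K)$ and $L(x,\lambda):=f(x)+\langle\lambda,g(x)\rangle$. All norms are Euclidean and $d(x,S):=\inf_{u\in S}\|x-u\|$. For $d\in\mathbb{R}^n$ and $\rho,\delta>0$ let $$V_{\rho,\delta}(d):=\{w\in\mathbb{R}^n \mid \|w\|\le\delta,\ \big\|\,\|d\|w-\|w\|d\,\big\|\le\rho\|w\|\|d\|\}.$$ For a set $S$, a point $x$ and a direction $u$, define: - the tangent cone $T_S(x):=\{d \mid \exists\, t_k\downarrow0,\ d_k\to d \text{ with } x+t_kd_k\in S \text{ for all } k\}$; - the Fréchet normal cone $\hat N_S(x):=\{v \mid \limsup_{y\to x,\,y\in S}\langle v,y-x\rangle/\|y-x\|\le0\}$ if $x\in S$, and $\hat N_S(x):=\emptyset$ if $x\notin S$; - the directional limiting normal cone $N_S(x;u):=\{v \mid \exists\, t_k\downarrow0,\ u_k\to u,\ v_k\to v \text{ with } v_k\in\hat N_S(x+t_ku_k) \text{ for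 all } k\}$. Let $\bar x\in C$ and $d\in T_C(\bar x)$, and suppose that $\bar x$ is a local optimal solution of $\min f(x)$ s.t. $g(x)\in K$ in direction $d$, that is, there are $\rho,\delta>0$ such that $f(x)\ge f(\bar x)$ for all $x\in C\cap(\bar x+V_{\rho,\delta}(d))$. Suppose that $\nabla f(\bar x)d=0$ and that the metric subregularity constraint qualification (MSCQ) holds at $\bar x$ in direction $d$ for the system $g(x)\in K$ with modulus $\kappa$, that is, there are $\rho,\delta,\kappa'>0$ such that $$d(x,C)\le\kappa'\,d(g(x),K)\qquad\text{for all } x\in\bar x+V_{\rho,\delta}(d),$$ and $\kappa$ is the infimum of all such $\kappa'$ (over all combinations $\rho,\delta,\kappa'>0$ with this property). Then there exists $\lambda\in N_K(g(\bar x);\nabla g(\bar x)d)$ such that $$\nabla_xL(\bar x,\lambda)=0\qquad\text{and}\qquad\|\lambda\|\le\kappa\|\nabla f(\bar x)\|.$$ -/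

import Mathlib

open Filter Topology

/-- The Bouligand (contingent) tangent cone `T_S(x)`: all `d` for which there are `t_k ↓ 0` and
`d_k → d` with `x + t_k d_k ∈ S`. -/
def bouligandTangentCone {E : Type*} [NormedAddCommGroup E] [NormedSpace ℝ E]
    (S : Set E) (x : E) : Set E :=
  {d | ∃ (t : ℕ → ℝ) (u : ℕ → E), (∀ k, 0 < t k) ∧ Tendsto t atTop (𝓝 0) ∧
    Tendsto u atTop (𝓝 d) ∧ ∀ k, x + t k • u k ∈ S}

/-- The Fréchet normal cone to `S` at `x`: all `v` with
`limsup ⟨v, y - x⟩ / ‖y - x‖ ≤ 0` as `y → x` within `S`; it is empty if `x ∉ S`. -/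
def frechetNormalCone {E : Type*} [NormedAddCommGroup E] [InnerProductSpace ℝ E]
    (S : Set E) (x : E) : Set E :=
  {v | x ∈ S ∧ ∀ ε : ℝ, 0 < ε → ∀ᶠ y in 𝓝[S] x, inner ℝ v (y - x) ≤ ε * ‖y - x‖}

/-- The directional limiting normal cone `N_S(x; d)`, the Painlevé-Kuratowski upper limit of the
Fréchet normal cones to `S` at `x + t d'` as `t ↓ 0` and `d' → d`. -/
def dirLimitingNormalCone {E : Type*} [NormedAddCommGroup E] [InnerProductSpace ℝ E]
    (S : Set E) (x d : E) : Set E :=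
  {v | ∃ (t : ℕ → ℝ) (u w : ℕ → E), (∀ k, 0 < t k) ∧ Tendsto t atTop (𝓝 0) ∧
    Tendsto u atTop (𝓝 d) ∧ Tendsto w atTop (𝓝 v) ∧
    ∀ k, w k ∈ frechetNormalCone S (x + t k • u k)}

/-- The directional neighborhood `V_{ρ,δ}(d)` of the direction `d`. -/
def dirNhd {E : Type*} [NormedAddCommGroup E] [NormedSpace ℝ E] (ρ δ : ℝ) (d : E) : Set E :=
  {w | ‖w‖ ≤ δ ∧ ‖(‖d‖ • w - ‖w‖ • d)‖ ≤ ρ * ‖w‖ * ‖d‖}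

/-- `x₀` is a local optimal solution of `min f(x)` subject to `x ∈ C` in direction `d`. -/
def IsDirLocalMin {E : Type*} [NormedAddCommGroup E] [NormedSpace ℝ E]
    (f : E → ℝ) (C : Set E) (x₀ d : E) : Prop :=
  x₀ ∈ C ∧ ∃ ρ δ : ℝ, 0 < ρ ∧ 0 < δ ∧
    ∀ x ∈ C, x - x₀ ∈ dirNhd ρ δ d → f x₀ ≤ f x

/-- For a set-valued map `M` and a point `(x₀, y₀)` of its graph: the estimate
`d(x, M⁻¹(y₀)) ≤ κ d(y₀, M(x))` holds for all `x ∈ x₀ + V_{ρ,δ}(d)`, for some `ρ, δ > 0`.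
Distances take values in `[0, ∞]`; the distance to the empty set is `∞`. -/
def DirMetricSubregularWith {E F : Type*} [NormedAddCommGroup E] [NormedSpace ℝ E]
    [NormedAddCommGroup F] (M : E → Set F) (x₀ : E) (y₀ : F) (d : E) (κ : ℝ) : Prop :=
  0 < κ ∧ ∃ ρ δ : ℝ, 0 < ρ ∧ 0 < δ ∧ ∀ x, x - x₀ ∈ dirNhd ρ δ d →
    Metric.infEDist x {u | y₀ ∈ M u} ≤ ENNReal.ofReal κ * Metric.infEDist y₀ (M x)

/-- `M` is metrically subregular at `(x₀, y₀)` in direction `d`. -/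
def DirMetricSubregular {E F : Type*} [NormedAddCommGroup E] [NormedSpace ℝ E]
    [NormedAddCommGroup F] (M : E → Set F) (x₀ : E) (y₀ : F) (d : E) : Prop :=
  ∃ κ : ℝ, DirMetricSubregularWith M x₀ y₀ d κ

/-- The modulus of directional metric subregularity: the infimum of all admissible constants
(a nonempty set of positive numbers if `M` is metrically subregular in direction `d`). -/
noncomputable def dirSubregularityModulus {E F : Type*} [NormedAddCommGroup E] [NormedSpace ℝ E]
    [NormedAddCommGroup F] (M : E → Set F) (x₀ : E) (y₀ : F) (d : E) : ℝ :=
  sInf {κ : ℝ | DirMetricSubregularWith M x₀ y₀ d κ}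

/-- The set-valued map `M(x) = g(x) - K` of the constraint system `g(x) ∈ K`. -/
def constraintMap {E F : Type*} [AddCommGroup F] (g : E → F) (K : Set F) : E → Set F :=
  fun x => {y | ∃ z ∈ K, y = g x - z}

/-- The metric subregularity constraint qualification for the system `g(x) ∈ K` holds at `x₀` in
direction `d` with modulus `κ`. -/
def DirMSCQ {E F : Type*} [NormedAddCommGroup E] [NormedSpace ℝ E] [NormedAddCommGroup F]
    (g : E → F) (K : Set F) (x₀ d : E) (κ : ℝ) : Prop :=
  DirMetricSubregular (constraintMap g K) x₀ 0 d ∧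
    dirSubregularityModulus (constraintMap g K) x₀ 0 d = κ

/-- The Lagrangian `L(x, λ) = f(x) + ⟨λ, g(x)⟩`. -/
noncomputable def lagrangian {E F : Type*} [NormedAddCommGroup F] [InnerProductSpace ℝ F]
    (f : E → ℝ) (g : E → F) (x : E) (l : F) : ℝ :=
  f x + inner ℝ l (g x)

section DirectionalMultiplier

variable {E F : Type*} [NormedAddCommGroup E] [InnerProductSpace ℝ E]
  [NormedAddCommGroup F] [InnerProductSpace ℝ F]


/-! Tangency and `∇f(x₀) d = 0` give feasible points `p = x₀ + t v` with `v → d` and `f p - f x₀ =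
o(t)`. In a ball of radius `η t` around `p`, directional subregularity turns directional optimality
into exact penalization: `f + c · dist(g ·, K) ≥ f x₀`, with `c` close to `κ ‖∇f(x₀)‖`. So `p` is an
`o(t)`-minimizer of the penalty function. Adding `‖x - p‖² / t`, as in Ekeland's principle, gives an
exact minimizer at distance `o(t)` from `p`, where the added gradient tends to `0`. Fermat's rule
there yields a proximal normal to `K` of norm at most `c` (`exists_multiplier_of_penalty`), based at
`g x₀ + t u` with `u` close to `∇g(x₀) d` (`exists_approx_multiplier`). These normals are bounded,
and any cluster point is the multiplier. -/

theorem exists_smul_mem_dirNhd {ρ δ : ℝ} (hρ : 0 < ρ) (hδ : 0 < δ) (d : E) :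
    ∃ η > 0, ∃ s > 0, ∀ t : ℝ, 0 < t → t < s → ∀ v : E, ‖v - d‖ ≤ η → t • v ∈ dirNhd ρ δ d := by
  have key : ∃ η > 0, ∀ v : E, ‖v - d‖ ≤ η → ‖(‖d‖ • v - ‖v‖ • d)‖ ≤ ρ * ‖v‖ * ‖d‖ := by
    by_cases hd : d = 0
    · exact ⟨1, one_pos, fun v _ => by simp [hd]⟩
    · have hpos : 0 < ‖d‖ := norm_pos_iff.2 hd
      have h1 : ContinuousAt (fun v : E => ‖(‖d‖ • v - ‖v‖ • d)‖) d := by fun_prop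
      have h2 : ContinuousAt (fun v : E => ρ * ‖v‖ * ‖d‖) d := by fun_prop
      have h3 : ∀ᶠ v in 𝓝 d, ‖(‖d‖ • v - ‖v‖ • d)‖ < ρ * ‖v‖ * ‖d‖ :=
        h1.eventually_lt h2 (by simp only [sub_self, norm_zero]; positivity)
      obtain ⟨η, hη, h⟩ := Metric.eventually_nhds_iff.1 h3
      exact ⟨η / 2, by positivity, fun v hv => (h (by rw [dist_eq_norm]; linarith)).le⟩
  obtain ⟨η, hη, h⟩ := key
  refine ⟨η, hη, δ / (‖d‖ + η), by positivity, fun t ht hts v hv => ⟨?_, ?_⟩⟩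
  · have hv' : ‖v‖ ≤ ‖d‖ + η := by
      have := norm_le_norm_add_norm_sub' v d
      linarith
    rw [norm_smul, Real.norm_of_nonneg ht.le]
    calc t * ‖v‖ ≤ δ / (‖d‖ + η) * (‖d‖ + η) := by gcongr
      _ = δ := by field_simp
  · have e : ‖d‖ • t • v - ‖t • v‖ • d = t • (‖d‖ • v - ‖v‖ • d) := by
      rw [norm_smul, Real.norm_of_nonneg ht.le]
      module
    rw [e, norm_smul, norm_smul, Real.norm_of_nonneg ht.le]
    nlinarith [mul_le_mul_of_nonneg_left (h v hv) ht.le]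

/-! ### Proximal normals and the smoothed penalty function -/

/-- Proximal normals are Fréchet normals. -/
theorem smul_sub_mem_frechetNormalCone {K : Set F} {z y : F} (hy : y ∈ K)
    (hmin : ∀ y' ∈ K, ‖z - y‖ ≤ ‖z - y'‖) {a : ℝ} (ha : 0 ≤ a) :
    a • (z - y) ∈ frechetNormalCone K y := by
  refine ⟨hy, fun ε hε => ?_⟩
  have hb : ∀ᶠ y' in 𝓝[K] y, ‖y' - y‖ < ε / (a + 1) := by
    refine mem_nhdsWithin_of_mem_nhds ?_
    filter_upwards [Metric.ball_mem_nhds y (show 0 < ε / (a + 1) by positivity)] with y' hy'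
    rwa [mem_ball_iff_norm] at hy'
  filter_upwards [hb, self_mem_nhdsWithin] with y' hy' hK
  have h1 : ‖z - y‖ ^ 2 ≤ ‖z - y'‖ ^ 2 := by
    have := hmin y' hK
    gcongr
  have h2 : ‖z - y'‖ ^ 2 = ‖z - y‖ ^ 2 - 2 * inner ℝ (z - y) (y' - y) + ‖y' - y‖ ^ 2 := by
    rw [← norm_sub_sq_real]
    congr 2
    abel
  rw [lt_div_iff₀ (by positivity)] at hy'
  rw [real_inner_smul_left]
  have h3 : inner ℝ (z - y) (y' - y) ≤ ‖y' - y‖ ^ 2 := by nlinarith [sq_nonneg ‖y' - y‖]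
  have h4 := mul_le_mul_of_nonneg_left h3 ha
  nlinarith [norm_nonneg (y' - y), mul_nonneg (norm_nonneg (y' - y)) (norm_nonneg (y' - y))]

/-- An approximate minimizer `p` of an exact penalty function has a nearby point that satisfies
approximate stationarity conditions with a multiplier in the Fréchet normal cone. -/
theorem exists_multiplier_of_penalty [FiniteDimensional ℝ E] [FiniteDimensional ℝ F]
    {f : E → ℝ} {g : E → F} {K : Set F}
    (hf : Differentiable ℝ f) (hg : Differentiable ℝ g) (hK : IsClosed K)
    {p : E} (hp : g p ∈ K) {t r c a e : ℝ} (ht : 0 < t) (hr : 0 < r) (hc : 0 < c)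
    (hpen : ∀ x, ‖x - p‖ ≤ r → ∀ y ∈ K, a ≤ f x + c * ‖g x - y‖)
    (he : f p - a < e) (her : e * t < r ^ 2) :
    ∃ x : E, ∃ y ∈ K, ∃ l ∈ frechetNormalCone K y, ‖x - p‖ ^ 2 ≤ e * t ∧
      ‖g x - y‖ ≤ ‖g x - g p‖ ∧ ‖l‖ ≤ c ∧
      ∀ h, fderiv ℝ f x h + inner ℝ l (fderiv ℝ g x h) + 2 / t * inner ℝ (x - p) h = 0 := by
  have hne : K.Nonempty := ⟨_, hp⟩
  -- The smoothing level spends exactly the slack in `he`, so that `ψ p = a + e`; `μ > 0` keeps the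
  -- square root differentiable when `g x ∈ K`.
  set μ : ℝ := (e - (f p - a)) / c with hμdef
  have hμ : 0 < μ := div_pos (by linarith) hc
  have hcμ : c * μ = e - (f p - a) := by rw [hμdef]; field_simp
  set ψ : E → ℝ := fun x =>
    f x + c * √(Metric.infDist (g x) K ^ 2 + μ ^ 2) + ‖x - p‖ ^ 2 / t with hψ
  have hcont : Continuous ψ := by
    have h1 := hf.continuous
    have h2 := (Metric.continuous_infDist_pt K).comp hg.continuous
    have h3 : Continuous fun x => Metric.infDist (g x) K := h2
    fun_prop
  obtain ⟨x, hxr, hxmin⟩ := (isCompact_closedBall p r).exists_isMinOn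
    ⟨p, Metric.mem_closedBall_self hr.le⟩ hcont.continuousOn
  rw [mem_closedBall_iff_norm] at hxr
  obtain ⟨y, hyK, hy⟩ := hK.exists_infDist_eq_dist hne (g x)
  rw [dist_eq_norm] at hy
  have hproj : ∀ y' ∈ K, ‖g x - y‖ ≤ ‖g x - y'‖ := fun y' hy' => by
    rw [← hy, ← dist_eq_norm]
    exact Metric.infDist_le_dist_of_mem hy'
  have hψp : ψ p = a + e := by
    have h0 : Metric.infDist (g p) K = 0 := Metric.infDist_zero_of_mem hp
    simp only [hψ, h0, sub_self, norm_zero]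
    rw [show (0 : ℝ) ^ 2 + μ ^ 2 = μ ^ 2 by ring, Real.sqrt_sq hμ.le, hcμ]
    ring
  have hxp : ‖x - p‖ ^ 2 ≤ e * t := by
    have h1 : ψ x ≤ ψ p := hxmin (Metric.mem_closedBall_self hr.le)
    have h2 := hpen x hxr y hyK
    have h3 : ‖g x - y‖ ≤ √(Metric.infDist (g x) K ^ 2 + μ ^ 2) := by
      rw [hy]
      exact Real.le_sqrt_of_sq_le (by nlinarith)
    have h4 := mul_le_mul_of_nonneg_left h3 hc.le
    rw [hψp] at h1
    simp only [hψ] at h1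
    rw [← div_le_iff₀ ht]
    linarith
  have hxr' : ‖x - p‖ < r := lt_of_pow_lt_pow_left₀ 2 hr.le (hxp.trans_lt her)
  set s : ℝ := √(‖g x - y‖ ^ 2 + μ ^ 2) with hs
  have hs0 : 0 < s := Real.sqrt_pos.2 (by positivity)
  have hys : ‖g x - y‖ ≤ s := Real.le_sqrt_of_sq_le (by nlinarith)
  -- The distance to `K` need not be differentiable. Freezing the projection `y` gives a
  -- differentiable majorant of `ψ` that agrees with it at `x`, so `x` stays a local minimizer.
  have hloc : IsLocalMin (fun x' => f x' + c * √(‖g x' - y‖ ^ 2 + μ ^ 2) + ‖x' - p‖ ^ 2 / t) x := by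
    have hball : ∀ᶠ x' in 𝓝 x, ‖x' - p‖ < r :=
      ContinuousAt.eventually_lt (by fun_prop) continuousAt_const hxr'
    filter_upwards [hball] with x' hx'
    have h1 : ψ x ≤ ψ x' := hxmin (mem_closedBall_iff_norm.2 hx'.le)
    simp only [hψ, hy] at h1
    refine h1.trans ?_
    have h2 : Metric.infDist (g x') K ≤ ‖g x' - y‖ := by
      rw [← dist_eq_norm]
      exact Metric.infDist_le_dist_of_mem hyK
    have h3 : 0 ≤ Metric.infDist (g x') K := Metric.infDist_nonneg
    gcongr
  have hder := (((hf x).hasFDerivAt.add ((((((hg x).hasFDerivAt.sub_const y).norm_sq).add_const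
    (μ ^ 2)).sqrt (by positivity)).const_mul c)).add
      ((((hasFDerivAt_id x).sub_const p).norm_sq).mul_const t⁻¹))
  simp only [div_eq_mul_inv] at hloc
  have hzero := hloc.hasFDerivAt_eq_zero hder
  refine ⟨x, y, hyK, (c / s) • (g x - y),
    smul_sub_mem_frechetNormalCone hyK hproj (by positivity), hxp, hproj _ hp, ?_, fun h => ?_⟩
  · rw [norm_smul, Real.norm_of_nonneg (by positivity), div_mul_eq_mul_div, div_le_iff₀ hs0]
    gcongr
  · have := DFunLike.congr_fun hzero h
    simp only [← hs, add_apply, smul_apply,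
      ContinuousLinearMap.comp_apply, innerSL_apply_apply, smul_eq_mul, nsmul_eq_mul,
      ContinuousLinearMap.id_apply, id_eq, zero_apply] at this
    rw [real_inner_smul_left, ← this]
    push_cast
    field_simp

/-! ### Subregularity estimates and difference quotients -/

theorem setOf_zero_mem_constraintMap {X G : Type*} [AddCommGroup G] (g : X → G) (K : Set G) :
    {u | (0 : G) ∈ constraintMap g K u} = g ⁻¹' K := by
  ext u
  simp only [constraintMap, Set.mem_ofPred_eq, Set.mem_preimage]
  constructor
  · rintro ⟨z, hz, h⟩
    rwa [sub_eq_zero.1 h.symm]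
  · exact fun h => ⟨_, h, (sub_self _).symm⟩

omit [InnerProductSpace ℝ F] in
theorem exists_proj_le_of_infEDist_le [FiniteDimensional ℝ E] {g : E → F} {K : Set F}
    (hC : IsClosed (g ⁻¹' K)) (hne : (g ⁻¹' K).Nonempty) {κ : ℝ} (hκ : 0 ≤ κ) {x : E}
    (hx : Metric.infEDist x {u | (0 : F) ∈ constraintMap g K u} ≤
      ENNReal.ofReal κ * Metric.infEDist 0 (constraintMap g K x)) :
    ∃ u ∈ g ⁻¹' K, (∀ z ∈ g ⁻¹' K, ‖x - u‖ ≤ ‖x - z‖) ∧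
      ∀ y ∈ K, ‖x - u‖ ≤ κ * ‖g x - y‖ := by
  rw [setOf_zero_mem_constraintMap] at hx
  obtain ⟨u, hu, hxu⟩ := hC.exists_infDist_eq_dist hne x
  rw [dist_eq_norm] at hxu
  refine ⟨u, hu, fun z hz => ?_, fun y hy => ?_⟩
  · rw [← hxu, ← dist_eq_norm]
    exact Metric.infDist_le_dist_of_mem hz
  · have h1 : Metric.infEDist 0 (constraintMap g K x) ≤ ENNReal.ofReal ‖g x - y‖ := by
      have hmem : g x - y ∈ constraintMap g K x := ⟨y, hy, rfl⟩
      refine (Metric.infEDist_le_edist_of_mem hmem).trans ?_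
      rw [edist_dist, dist_zero_left]
    rw [← hxu, Metric.infDist]
    refine ENNReal.toReal_le_of_le_ofReal (by positivity) ?_
    rw [ENNReal.ofReal_mul hκ]
    exact hx.trans (by gcongr)

/-- Difference quotients of a differentiable map along `t k ↓ 0` and `v k → d` tend to `g' d`. -/
theorem tendsto_slope_of_hasFDerivAt {G : Type*} [NormedAddCommGroup G] [NormedSpace ℝ G]
    {g : E → G} {g' : E →L[ℝ] G} {x₀ d : E} (hg : HasFDerivAt g g' x₀) {t : ℕ → ℝ} {v : ℕ → E}
    (ht0 : ∀ k, 0 < t k) (ht : Tendsto t atTop (𝓝 0)) (hv : Tendsto v atTop (𝓝 d)) :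
    Tendsto (fun k => (t k)⁻¹ • (g (x₀ + t k • v k) - g x₀)) atTop (𝓝 (g' d)) := by
  refine hg.hasFDerivWithinAt.lim (s := Set.univ) (by simpa using ht.smul hv) (by simp) ?_
  refine hv.congr fun k => ?_
  rw [smul_smul, inv_mul_cancel₀ (ht0 k).ne', one_smul]

/-! ### The multiplier rule, up to an error and in the limit -/

set_option maxHeartbeats 800000 in
/-- Approximate form of the directional multiplier rule. -/
theorem exists_approx_multiplier [FiniteDimensional ℝ E] [FiniteDimensional ℝ F]
    {f : E → ℝ} {g : E → F} {K : Set F} {x₀ d : E} {κ : ℝ}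
    (hf : ContDiff ℝ 1 f) (hg : ContDiff ℝ 1 g) (hK : IsClosed K)
    (hd : d ∈ bouligandTangentCone (g ⁻¹' K) x₀)
    (hmin : IsDirLocalMin f (g ⁻¹' K) x₀ d) (hfd : fderiv ℝ f x₀ d = 0)
    (hsub : DirMetricSubregularWith (constraintMap g K) x₀ 0 d κ) {τ : ℝ} (hτ : 0 < τ) :
    ∃ t : ℝ, 0 < t ∧ t < τ ∧ ∃ u l : F, ‖u - fderiv ℝ g x₀ d‖ < τ ∧
      l ∈ frechetNormalCone K (g x₀ + t • u) ∧ ‖l‖ ≤ κ * (‖fderiv ℝ f x₀‖ + τ) ∧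
      ∀ h, |fderiv ℝ f x₀ h + inner ℝ l (fderiv ℝ g x₀ h)| ≤ τ * ‖h‖ := by
  obtain ⟨T, v, hT0, hT, hv, hmem⟩ := hd
  obtain ⟨hx₀, ρ₁, δ₁, hρ₁, hδ₁, hmin⟩ := hmin
  obtain ⟨hκ, ρ₂, δ₂, hρ₂, hδ₂, hsub⟩ := hsub
  obtain ⟨η₁, hη₁, s₁, hs₁, hV₁⟩ := exists_smul_mem_dirNhd hρ₁ hδ₁ d
  obtain ⟨η₂, hη₂, s₂, hs₂, hV₂⟩ := exists_smul_mem_dirNhd hρ₂ hδ₂ d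
  have hdf : Differentiable ℝ f := hf.differentiable one_ne_zero
  have hdg : Differentiable ℝ g := hg.differentiable one_ne_zero
  have hC : IsClosed (g ⁻¹' K) := hK.preimage hg.continuous
  set A := fderiv ℝ f x₀ with hA
  set B := fderiv ℝ g x₀ with hB
  set c : ℝ := κ * (‖A‖ + τ) with hc
  have hc0 : 0 < c := by positivity
  -- a ball on which the derivatives are almost constant
  set ω : ℝ := min (τ / (2 * (1 + c))) (min τ 1) with hω
  have hω0 : 0 < ω := by positivity
  have hωτ : ω ≤ τ := (min_le_right _ _).trans (min_le_left _ _)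
  have hω1 : ω ≤ 1 := (min_le_right _ _).trans (min_le_right _ _)
  have hωc : ω * (1 + c) ≤ τ / 2 := by
    have : ω ≤ τ / (2 * (1 + c)) := min_le_left _ _
    rw [le_div_iff₀ (by positivity)] at this
    linarith
  have hev : ∀ᶠ x in 𝓝 x₀, ‖fderiv ℝ f x - A‖ < ω ∧ ‖fderiv ℝ g x - B‖ < ω := by
    have h1 : Continuous (fderiv ℝ f) := hf.continuous_fderiv one_ne_zero
    have h2 : Continuous (fderiv ℝ g) := hg.continuous_fderiv one_ne_zero
    refine Filter.Eventually.and ?_ ?_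
    · exact ContinuousAt.eventually_lt (by fun_prop) continuousAt_const (by simpa [hA] using hω0)
    · exact ContinuousAt.eventually_lt (by fun_prop) continuousAt_const (by simpa [hB] using hω0)
  obtain ⟨R, hR, hball⟩ := Metric.eventually_nhds_iff_ball.1 hev
  have hlipf : ∀ x ∈ Metric.ball x₀ R, ∀ z ∈ Metric.ball x₀ R,
      ‖f x - f z‖ ≤ (‖A‖ + τ) * ‖x - z‖ := fun x hx z hz => by
    refine (convex_ball x₀ R).norm_image_sub_le_of_norm_fderiv_le (fun y _ => hdf y)
      (fun y hy => ?_) hz hx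
    have := norm_le_norm_add_norm_sub' (fderiv ℝ f y) A
    linarith [(hball y hy).1]
  have hlipg : ∀ x ∈ Metric.ball x₀ R, ∀ z ∈ Metric.ball x₀ R,
      ‖g x - g z‖ ≤ (‖B‖ + 1) * ‖x - z‖ := fun x hx z hz => by
    refine (convex_ball x₀ R).norm_image_sub_le_of_norm_fderiv_le (fun y _ => hdg y)
      (fun y hy => ?_) hz hx
    have := norm_le_norm_add_norm_sub' (fderiv ℝ g y) B
    linarith [(hball y hy).2]
  -- One `η` for `v k - d` and two for the distance to `p`, as the projection of a point may double
  -- it.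
  set η : ℝ := min η₁ η₂ / 3 with hη
  have hη0 : 0 < η := by positivity
  have hη₁' : 3 * η ≤ η₁ := by linarith [min_le_left η₁ η₂]
  have hη₂' : 3 * η ≤ η₂ := by linarith [min_le_right η₁ η₂]
  set σ : ℝ := min (η / 2) (τ / (4 * (‖B‖ + 1))) with hσ
  have hσ0 : 0 < σ := by positivity
  have hση : σ < η := (min_le_left _ _).trans_lt (by linarith)
  have hσB : (‖B‖ + 1) * σ ≤ τ / 4 := by
    have : σ ≤ τ / (4 * (‖B‖ + 1)) := min_le_right _ _
    rw [le_div_iff₀ (by positivity)] at this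
    linarith
  have hσ4 : σ ≤ τ / 4 := (le_mul_of_one_le_left hσ0.le (by linarith [norm_nonneg B])).trans hσB
  have hf_slope := tendsto_slope_of_hasFDerivAt (hdf x₀).hasFDerivAt hT0 hT hv
  have hg_slope := tendsto_slope_of_hasFDerivAt (hdg x₀).hasFDerivAt hT0 hT hv
  rw [← hA, hfd] at hf_slope
  rw [← hB] at hg_slope
  have e1 : ∀ᶠ k in atTop, T k < min (min s₁ s₂) (min τ (R / (‖d‖ + 3 * η))) :=
    hT.eventually_lt_const (by positivity)
  have e2 : ∀ᶠ k in atTop, ‖v k - d‖ < η := by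
    simpa [dist_eq_norm] using (Metric.tendsto_nhds.1 hv) η hη0
  -- With gap `σ² t` and quadratic weight `1 / t`, the penalty minimizer lies within `σ t` of `p`.
  have e3 := hf_slope.eventually_lt_const (show (0 : ℝ) < σ ^ 2 by positivity)
  have e4 : ∀ᶠ k in atTop, ‖(T k)⁻¹ • (g (x₀ + T k • v k) - g x₀) - B d‖ < τ / 2 := by
    simpa [dist_eq_norm] using (Metric.tendsto_nhds.1 hg_slope) (τ / 2) (by positivity)
  obtain ⟨k, k1, k2, k3, k4⟩ := (e1.and (e2.and (e3.and e4))).exists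
  set t := T k with htdef
  have ht : 0 < t := hT0 k
  set p := x₀ + t • v k with hp
  have hpK : g p ∈ K := hmem k
  simp only [lt_min_iff] at k1
  obtain ⟨⟨ts₁, ts₂⟩, tτ, tR⟩ := k1
  rw [lt_div_iff₀ (by positivity)] at tR
  -- points close to `p` on the scale `t` are of the form `x₀ + t w` with `w` close to `d`
  have hrep : ∀ x, ‖x - p‖ ≤ 2 * (η * t) →
      ∃ w, x - x₀ = t • w ∧ ‖w - d‖ ≤ 3 * η ∧ x ∈ Metric.ball x₀ R := fun x hx => by
    have hxw : x - x₀ = t • (t⁻¹ • (x - x₀)) := by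
      rw [smul_smul, mul_inv_cancel₀ ht.ne', one_smul]
    have hw : ‖t⁻¹ • (x - x₀) - d‖ ≤ 3 * η := by
      have : t⁻¹ • (x - x₀) - d = t⁻¹ • (x - p) + (v k - d) := by
        have : t⁻¹ • (t • v k) = v k := by rw [smul_smul, inv_mul_cancel₀ ht.ne', one_smul]
        rw [hp, ← sub_sub, smul_sub _ (x - x₀), this]
        abel
      rw [this]
      refine (norm_add_le _ _).trans ?_
      have : ‖t⁻¹ • (x - p)‖ ≤ 2 * η := by
        rw [norm_smul, norm_inv, Real.norm_of_nonneg ht.le, inv_mul_le_iff₀ ht]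
        linarith
      linarith
    refine ⟨_, hxw, hw, ?_⟩
    rw [mem_ball_iff_norm, hxw, norm_smul, Real.norm_of_nonneg ht.le]
    refine lt_of_le_of_lt ?_ tR
    gcongr
    have := norm_le_norm_add_norm_sub' (t⁻¹ • (x - x₀)) d
    linarith
  have hpen : ∀ x, ‖x - p‖ ≤ η * t → ∀ y ∈ K, f x₀ ≤ f x + c * ‖g x - y‖ := fun x hx y hy => by
    have hηt : 0 < η * t := by positivity
    obtain ⟨w, hw, hwd, hxR⟩ := hrep x (by linarith)
    have hxV : x - x₀ ∈ dirNhd ρ₂ δ₂ d := hw ▸ hV₂ t ht ts₂ w (hwd.trans hη₂')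
    obtain ⟨u, huC, hproj, hu⟩ := exists_proj_le_of_infEDist_le hC ⟨p, hpK⟩ hκ.le (hsub x hxV)
    -- Since `p` is feasible, the projection `u` is no farther from `x` than `p` is; hence `u` stays
    -- in the region of directional optimality.
    have hup : ‖u - p‖ ≤ 2 * (η * t) := by
      have h1 := norm_sub_le_norm_sub_add_norm_sub u x p
      have h2 := hproj p hpK
      rw [norm_sub_rev u x] at h1
      linarith
    obtain ⟨w', hw', hwd', huR⟩ := hrep u hup
    have huV : u - x₀ ∈ dirNhd ρ₁ δ₁ d := hw' ▸ hV₁ t ht ts₁ w' (hwd'.trans hη₁')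
    have h1 := hmin u huC huV
    have h2 := (le_abs_self _).trans (hlipf u huR x hxR)
    rw [norm_sub_rev] at h2
    have h3 := mul_le_mul_of_nonneg_left (hu y hy) (show 0 ≤ ‖A‖ + τ by positivity)
    have h4 : (‖A‖ + τ) * (κ * ‖g x - y‖) = c * ‖g x - y‖ := by rw [hc]; ring
    linarith
  have hfp : f p - f x₀ < σ ^ 2 * t := by
    rw [smul_eq_mul, inv_mul_lt_iff₀ ht] at k3
    linarith
  have her : σ ^ 2 * t * t < (η * t) ^ 2 := by
    have : (σ * t) ^ 2 < (η * t) ^ 2 := by gcongr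
    linarith
  obtain ⟨x, y, hyK, l, hl, hxp, hxy, hlc, hstat⟩ :=
    exists_multiplier_of_penalty hdf hdg hK hpK ht (by positivity) hc0 hpen hfp her
  have hxp' : ‖x - p‖ ≤ σ * t :=
    le_of_sq_le_sq (by linarith) (by positivity)
  have hσηt : σ * t ≤ 2 * (η * t) := by linarith [mul_lt_mul_of_pos_right hση ht, mul_pos hη0 ht]
  obtain ⟨-, -, -, hxR⟩ := hrep x (hxp'.trans hσηt)
  obtain ⟨-, -, -, hpR⟩ := hrep p (by rw [sub_self, norm_zero]; positivity)
  refine ⟨t, ht, tτ, t⁻¹ • (y - g x₀), l, ?_, ?_, hlc, fun h => ?_⟩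
  · have h1 : ‖y - g p‖ ≤ τ / 2 * t := by
      have h2 := norm_sub_le_norm_sub_add_norm_sub y (g x) (g p)
      have h3 := hlipg x hxR p hpR
      rw [norm_sub_rev y (g x)] at h2
      have h4 : (‖B‖ + 1) * ‖x - p‖ ≤ (‖B‖ + 1) * (σ * t) := by gcongr
      have h5 := mul_le_mul_of_nonneg_right hσB ht.le
      linarith
    have h2 : t⁻¹ • (y - g x₀) - B d = t⁻¹ • (y - g p) + (t⁻¹ • (g p - g x₀) - B d) := by
      module
    have h3 : ‖t⁻¹ • (y - g p)‖ ≤ τ / 2 := by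
      rw [norm_smul, norm_inv, Real.norm_of_nonneg ht.le, inv_mul_le_iff₀ ht]
      linarith
    rw [h2]
    linarith [norm_add_le (t⁻¹ • (y - g p)) (t⁻¹ • (g p - g x₀) - B d)]
  · rwa [smul_smul, mul_inv_cancel₀ ht.ne', one_smul, add_sub_cancel]
  · have h0 : A h + inner ℝ l (B h) =
        -((fderiv ℝ f x - A) h + inner ℝ l ((fderiv ℝ g x - B) h) +
          2 / t * inner ℝ (x - p) h) := by
      have := hstat h
      simp only [sub_apply, inner_sub_right]
      linarith
    have h1 : |(fderiv ℝ f x - A) h| ≤ ω * ‖h‖ :=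
      (fderiv ℝ f x - A).le_of_opNorm_le (hball x hxR).1.le h
    have h2 : |inner ℝ l ((fderiv ℝ g x - B) h)| ≤ c * (ω * ‖h‖) := by
      refine (abs_real_inner_le_norm _ _).trans ?_
      gcongr
      exact (fderiv ℝ g x - B).le_of_opNorm_le (hball x hxR).2.le h
    have h3 : |2 / t * inner ℝ (x - p) h| ≤ 2 * σ * ‖h‖ := by
      rw [abs_mul, abs_of_pos (by positivity)]
      calc 2 / t * |inner ℝ (x - p) h| ≤ 2 / t * (σ * t * ‖h‖) := by
            gcongr
            exact (abs_real_inner_le_norm _ _).trans (by gcongr)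
        _ = 2 * σ * ‖h‖ := by field_simp
    rw [h0, abs_neg]
    have h4 := abs_add_three ((fderiv ℝ f x - A) h) (inner ℝ l ((fderiv ℝ g x - B) h))
      (2 / t * inner ℝ (x - p) h)
    have h5 := mul_le_mul_of_nonneg_right hωc (norm_nonneg h)
    have h6 := mul_le_mul_of_nonneg_right hσ4 (norm_nonneg h)
    linarith

/-- The directional multiplier rule in finite-dimensional inner product spaces. -/
theorem exists_dirLimitingNormalCone_multiplier [FiniteDimensional ℝ E] [FiniteDimensional ℝ F]
    {f : E → ℝ} {g : E → F} {K : Set F} {x₀ d : E} {κ : ℝ}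
    (hf : ContDiff ℝ 1 f) (hg : ContDiff ℝ 1 g) (hK : IsClosed K)
    (hd : d ∈ bouligandTangentCone (g ⁻¹' K) x₀)
    (hmin : IsDirLocalMin f (g ⁻¹' K) x₀ d) (hfd : fderiv ℝ f x₀ d = 0)
    (hMSCQ : DirMSCQ g K x₀ d κ) :
    ∃ l ∈ dirLimitingNormalCone K (g x₀) (fderiv ℝ g x₀ d),
      (∀ h, fderiv ℝ f x₀ h + inner ℝ l (fderiv ℝ g x₀ h) = 0) ∧
        ‖l‖ ≤ κ * ‖fderiv ℝ f x₀‖ := by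
  obtain ⟨hne, rfl⟩ := hMSCQ
  set κ := dirSubregularityModulus (constraintMap g K) x₀ 0 d with hκ
  have happrox : ∀ k : ℕ, ∃ t : ℝ, 0 < t ∧ t < 1 / ((k : ℝ) + 1) ∧ ∃ u l : F,
      ‖u - fderiv ℝ g x₀ d‖ < 1 / ((k : ℝ) + 1) ∧ l ∈ frechetNormalCone K (g x₀ + t • u) ∧
      ‖l‖ ≤ (κ + 1 / ((k : ℝ) + 1)) * (‖fderiv ℝ f x₀‖ + 1 / ((k : ℝ) + 1)) ∧
      ∀ h, |fderiv ℝ f x₀ h + inner ℝ l (fderiv ℝ g x₀ h)| ≤ 1 / ((k : ℝ) + 1) * ‖h‖ := fun k => by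
    have hτ : 0 < 1 / ((k : ℝ) + 1) := by positivity
    -- The modulus need not be an admissible constant itself, so it is only approached.
    obtain ⟨κ', hκ', hlt⟩ := exists_lt_of_csInf_lt hne (lt_add_of_pos_right κ hτ)
    obtain ⟨t, h1, h2, u, l, h3, h4, h5, h6⟩ :=
      exists_approx_multiplier hf hg hK hd hmin hfd hκ' hτ
    exact ⟨t, h1, h2, u, l, h3, h4, h5.trans (by gcongr), h6⟩
  choose t ht0 ht u l hu hl hlb hst using happrox
  have hτ := tendsto_one_div_add_atTop_nhds_zero_nat (𝕜 := ℝ)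
  have hbound : Tendsto (fun k : ℕ => (κ + 1 / ((k : ℝ) + 1)) *
      (‖fderiv ℝ f x₀‖ + 1 / ((k : ℝ) + 1))) atTop (𝓝 (κ * ‖fderiv ℝ f x₀‖)) := by
    simpa using (hτ.const_add κ).mul (hτ.const_add ‖fderiv ℝ f x₀‖)
  obtain ⟨M, hM⟩ := hbound.bddAbove_range
  have hlM : ∀ k, l k ∈ Metric.closedBall (0 : F) M := fun k => by
    rw [mem_closedBall_zero_iff]
    exact (hlb k).trans (hM ⟨k, rfl⟩)
  obtain ⟨l₀, -, φ, hφ, hlim⟩ := (isCompact_closedBall (0 : F) M).tendsto_subseq hlM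
  have hφt := hφ.tendsto_atTop
  refine ⟨l₀, ⟨t ∘ φ, u ∘ φ, l ∘ φ, fun k => ht0 _, ?_, ?_, hlim, fun k => hl _⟩, fun h => ?_, ?_⟩
  · exact (squeeze_zero (fun k => (ht0 k).le) (fun k => (ht k).le) hτ).comp hφt
  · exact (tendsto_iff_norm_sub_tendsto_zero.2
      (squeeze_zero (fun k => norm_nonneg _) (fun k => (hu k).le) hτ)).comp hφt
  · have h1 : Tendsto (fun k => |fderiv ℝ f x₀ h + inner ℝ (l (φ k)) (fderiv ℝ g x₀ h)|) atTop
        (𝓝 |fderiv ℝ f x₀ h + inner ℝ l₀ (fderiv ℝ g x₀ h)|) :=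
      ((hlim.inner tendsto_const_nhds).const_add _).abs
    have h2 : Tendsto (fun k => 1 / ((φ k : ℝ) + 1) * ‖h‖) atTop (𝓝 0) := by
      simpa using (hτ.comp hφt).mul_const ‖h‖
    exact abs_nonpos_iff.1 (le_of_tendsto_of_tendsto' h1 h2 fun k => hst (φ k) h)
  · exact le_of_tendsto_of_tendsto' hlim.norm (hbound.comp hφt) fun k => hlb (φ k)

end DirectionalMultiplier

theorem proposition4p1 {n m : ℕ}
    (f : EuclideanSpace ℝ (Fin n) → ℝ)
    (g : EuclideanSpace ℝ (Fin n) → EuclideanSpace ℝ (Fin m))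
    (K : Set (EuclideanSpace ℝ (Fin m)))
    (x₀ d : EuclideanSpace ℝ (Fin n)) (κ : ℝ)
    (hf : ContDiff ℝ 1 f) (hg : ContDiff ℝ 1 g) (hK : IsClosed K)
    (hd : d ∈ bouligandTangentCone (g ⁻¹' K) x₀)
    (hmin : IsDirLocalMin f (g ⁻¹' K) x₀ d)
    (hfd : fderiv ℝ f x₀ d = 0)
    (hMSCQ : DirMSCQ g K x₀ d κ) :
    ∃ l ∈ dirLimitingNormalCone K (g x₀) (fderiv ℝ g x₀ d),
      gradient (fun x => lagrangian f g x l) x₀ = 0 ∧ ‖l‖ ≤ κ * ‖gradient f x₀‖ := by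
  obtain ⟨l, hl, hst, hb⟩ := exists_dirLimitingNormalCone_multiplier hf hg hK hd hmin hfd hMSCQ
  refine ⟨l, hl, ?_, by simpa [gradient] using hb⟩
  have hdf := (hf.differentiable one_ne_zero x₀).hasFDerivAt
  have hdg := (hg.differentiable one_ne_zero x₀).hasFDerivAt
  have hder : HasFDerivAt (fun x => lagrangian f g x l)
      (fderiv ℝ f x₀ + (innerSL ℝ l).comp (fderiv ℝ g x₀)) x₀ :=
    hdf.add ((innerSL ℝ l).hasFDerivAt.comp x₀ hdg)
  have hzero : fderiv ℝ f x₀ + (innerSL ℝ l).comp (fderiv ℝ g x₀) = 0 := by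
    ext h
    simpa using hst h
  rw [gradient, hder.fderiv, hzero, map_zero]
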